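/- Let $T$ (targets) and $D$ (depots) be disjoint finite sets, let $C_1,\dots,C_m$ be a partition of $T$ into nonempty clusters, and let $G=(V,E)$ be the undirected graph with $V=T\cup D$ whose edges are all pairs $\{i,j\}$ of distinct vertices with at least one end in $T$. For $x\in\mathbb{R}^{E}$ and $F\subseteq E$ put $x(F)=\sum_{e\in F}x_e$; for $S\subseteq V$ let $\gamma(S)$ be the set of edges with both ends in $S$ and $\delta(S)$ the set of edges with exactly one end in $S$; for disjoint $A,B\subseteq V$ let $(A:B)$ be the set of edges with one end in $A$ and the other in $B$, and write $x(A:B)=x((A:B))$. A feasible GMDTSP solution is a vector $(x,y)\in\mathbb{R}^{E}\times\mathbb{R}^{T}$ such that 1. $x(\delta(\{i\}))=2y_i$ for all $i\in T$; 2. $\sum_{i\in C_h}y_i\ge 1$ for all $h=1,\dots,m$; 3. $x(\delta(S))\ge 2y_i$ for all $S\subseteq T$ and $i\in S$; 4. $x(D':\{j\})+3x_{jk}+x(\{k\}:D\setminus D')\le 2(y_j+y_k)$ for all distinct $j,k\in T$ and all $D'\subseteq D$; 5. $x(D':\{j\})+2x(\gamma(S\cup\{j,k\}))+x(\{k\}:D\setminus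 D')\le\sum_{v\in S}2y_v+2(y_j+y_k)-y_i$ for all distinct $j,k\in T$, all nonempty $S\subseteq T\setminus\{j,k\}$, all $i\in S$ and all $D'\subseteq D$; 6. $x_e\in\{0,1\}$ for $e\in\gamma(T)$, $x_e\in\{0,1,2\}$ for $e\in(D:T)$, and $y_i\in\{0,1\}$ for $i\in T$. Let $P\subseteq\mathbb{R}^{E}\times\mathbb{R}^{T}$ be the convex hull of all feasible GMDTSP solutions. An inequality is facet-defining for $P$ if it is valid for $P$ and the set of points of $P$ satisfying it with equality is nonempty and has affine dimension $\dim P-1$. Then for all distinct targets $j,k\in T$ and every nonempty proper subset $D'\subsetneq D$, the inequality $$x(D':\{j\})+3x_{jk}+x(\{k\}:D\setminus D')+\bar\beta_j(1-y_j)+\bar\beta_k(1-y_k)\le 4,\qquad \bar\beta_j=\bar\beta_k=2,$$ or, in rewritten form, $$x(D':\{j\})+3x_{jk}+x(\{k\}:D\setminus D')\le 2(y_j+y_k),$$ is valid and facet-defining for $P$. -/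

import Mathlib

namespace GMDTSP

/-- The vertex set `V = T ∪ D` (disjoint union of targets and depots). -/
abbrev Vertex (T D : Type*) := T ⊕ D

/-- The edge set `E`: all unordered pairs of distinct vertices, at least one of which is a target. -/
abbrev Edge (T D : Type*) := {e : Sym2 (Vertex T D) // ¬ e.IsDiag ∧ ∃ t : T, Sum.inl t ∈ e}

noncomputable instance instFintypeEdge (T D : Type*) [Fintype T] [Fintype D] :
    Fintype (Edge T D) := Fintype.ofFinite _

/-- The space `ℝ^{|E|+|T|}` of vectors `(x, y)`. -/
abbrev Space (T D : Type*) := (Edge T D → ℝ) × (T → ℝ)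

section Edges

variable {T D : Type*}

/-- The edge joining two distinct targets. -/
def targetEdge (j k : T) (h : j ≠ k) : Edge T D :=
  ⟨s(Sum.inl j, Sum.inl k), by simpa using h, ⟨j, by simp⟩⟩

/-- `γ(S)`: the edges with both ends in `S`. -/
def gam (S : Set (Vertex T D)) : Set (Edge T D) := {e | ∀ v ∈ e.1, v ∈ S}

/-- `(A : B)`: the edges with one end in `A` and the other end in `B`. -/
def between (A B : Set (Vertex T D)) : Set (Edge T D) :=
  {e | ∃ a ∈ A, ∃ b ∈ B, e.1 = s(a, b)}

/-- `δ(S)`: the edges with exactly one end in `S`. -/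
def del (S : Set (Vertex T D)) : Set (Edge T D) := between S Sᶜ

/-- A set of targets, as a set of vertices. -/
def tgt (S : Set T) : Set (Vertex T D) := Sum.inl '' S

/-- A set of depots, as a set of vertices. -/
def dep (D' : Set D) : Set (Vertex T D) := Sum.inr '' D'

/-- `x(F) = ∑_{e ∈ F} x_e` for a set `F` of edges. -/
noncomputable def edgeSum [Fintype T] [Fintype D] (x : Edge T D → ℝ) (F : Set (Edge T D)) : ℝ :=
  ∑ e, F.indicator x e

/-- The left-hand side `x(D' : {j}) + 3 x_{jk} + x({k} : D ∖ D')`. -/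
noncomputable def pathLHS [Fintype T] [Fintype D] (j k : T) (hjk : j ≠ k) (D' : Set D)
    (x : Edge T D → ℝ) : ℝ :=
  edgeSum x (between (dep D') (tgt {j})) + 3 * x (targetEdge j k hjk)
    + edgeSum x (between (tgt {k}) (dep D'ᶜ))

end Edges

section Polytope

variable {T D : Type*} [Fintype T] [DecidableEq T] [Fintype D]

/-- `(x, y)` is a feasible solution of the integer programming formulation; the clusters are the
(nonempty, pairwise disjoint) parts of the partition `C` of the set of targets. -/
structure IsFeasible (C : Finpartition (Finset.univ : Finset T)) (p : Space T D) : Prop where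
  degree : ∀ i : T, edgeSum p.1 (del (tgt {i})) = 2 * p.2 i
  assignment : ∀ A ∈ C.parts, 1 ≤ ∑ i ∈ A, p.2 i
  subtour : ∀ (S : Set T), ∀ i ∈ S, 2 * p.2 i ≤ edgeSum p.1 (del (tgt S))
  fourPath : ∀ (j k : T) (hjk : j ≠ k) (D' : Set D),
    pathLHS j k hjk D' p.1 ≤ 2 * (p.2 j + p.2 k)
  path : ∀ (j k : T), j ≠ k → ∀ (S : Finset T), j ∉ S → k ∉ S → ∀ i ∈ S, ∀ (D' : Set D),
    edgeSum p.1 (between (dep D') (tgt {j})) + 2 * edgeSum p.1 (gam (tgt (↑S ∪ {j, k})))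
        + edgeSum p.1 (between (tgt {k}) (dep D'ᶜ))
      ≤ ∑ v ∈ S, 2 * p.2 v + 2 * (p.2 j + p.2 k) - p.2 i
  x_target : ∀ e ∈ (gam (tgt Set.univ) : Set (Edge T D)), p.1 e = 0 ∨ p.1 e = 1
  x_depot : ∀ e ∈ (between (dep Set.univ) (tgt Set.univ) : Set (Edge T D)),
    p.1 e = 0 ∨ p.1 e = 1 ∨ p.1 e = 2
  y_binary : ∀ i : T, p.2 i = 0 ∨ p.2 i = 1

/-- The polytope `P`: the convex hull of the feasible solutions. -/
def polytope (D : Type*) [Fintype D] (C : Finpartition (Finset.univ : Finset T)) :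
    Set (Space T D) :=
  convexHull ℝ {p | IsFeasible C p}

end Polytope

section Facets

variable {V : Type*} [AddCommGroup V] [Module ℝ V]

/-- The affine dimension of a nonempty set. -/
noncomputable def affDim (s : Set V) : ℕ := Module.finrank ℝ (vectorSpan ℝ s)

/-- The inequality `f ≤ g` (with `f`, `g` affine) is valid for `P`. -/
def IsValid (P : Set V) (f g : V → ℝ) : Prop := ∀ p ∈ P, f p ≤ g p

/-- The inequality `f ≤ g` (with `f`, `g` affine) is facet-defining for `P`: it is valid and the
face of `P` on which it is tight is nonempty of dimension `dim P - 1`. -/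
def IsFacetDefining (P : Set V) (f g : V → ℝ) : Prop :=
  IsValid P f g ∧ {p ∈ P | f p = g p}.Nonempty ∧ affDim {p ∈ P | f p = g p} + 1 = affDim P

end Facets

end GMDTSP

/-! Validity is immediate: the inequality is one of the constraints on feasible solutions, and
linear inequalities pass to the convex hull. For the facet property it suffices that a linear
functional `f` that is constant on the tight face and takes the same value at one non-tight point
`q` of the polytope is constant on it (`affDim_add_one_of_forall_functional`).

The tool is an exchange argument. Serving every target alone, `j` from a depot in `D'` and `k` from
one outside, is feasible and tight. Replacing the single tours on a set of targets by another tight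
tour on that set keeps both properties, so `f` agrees on the two pieces (`map_eq_sum_tour₁`). Tours
on at most three targets, together with `q`, then force weights `α` with coefficient `α t` on every
depot edge at `t` and `α u + α v` on every target edge. By the degree equations `f` depends on `y`
alone (`map_eq_sum_of_edge_weights`). The coefficient of `y_t` vanishes if `t` can be dropped;
otherwise `{t}` is a cluster and `y_t = 1` throughout. -/

namespace GMDTSP

set_option linter.unusedSectionVars false

/-! ### Depot edges, target edges and their incidences -/

section Edges

variable {T D : Type*}

/-- The edge joining a depot and a target. -/
def depotEdge (d : D) (t : T) : Edge T D :=
  ⟨s(Sum.inr d, Sum.inl t), by simp, ⟨t, by simp⟩⟩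

lemma edge_cases (e : Edge T D) :
    (∃ d t, e = depotEdge d t) ∨ ∃ u v h, e = targetEdge u v h := by
  obtain ⟨e, hd, t, ht⟩ := e
  obtain ⟨w, rfl⟩ := Sym2.mem_iff_exists.1 ht
  rcases w with v | d
  · exact Or.inr ⟨t, v, fun h => hd (by simp [h]), rfl⟩
  · exact Or.inl ⟨d, t, Subtype.ext Sym2.eq_swap⟩

lemma targetEdge_swap (u v : T) (h : u ≠ v) :
    (targetEdge u v h : Edge T D) = targetEdge v u h.symm := Subtype.ext Sym2.eq_swap

@[simp] lemma inl_mem_depotEdge (d : D) (t i : T) :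
    (Sum.inl i : Vertex T D) ∈ (depotEdge d t).1 ↔ i = t := by
  simp [depotEdge]

@[simp] lemma inl_mem_targetEdge (u v i : T) (h : u ≠ v) :
    (Sum.inl i : Vertex T D) ∈ (targetEdge u v h : Edge T D).1 ↔ i = u ∨ i = v := by
  simp [targetEdge]

@[simp] lemma depotEdge_inj (d d' : D) (t t' : T) :
    depotEdge d t = depotEdge d' t' ↔ d = d' ∧ t = t' := by
  simp [depotEdge, Subtype.ext_iff]

@[simp] lemma targetEdge_eq_iff (u v u' v' : T) (h : u ≠ v) (h' : u' ≠ v') :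
    (targetEdge u v h : Edge T D) = targetEdge u' v' h' ↔
      (u = u' ∧ v = v') ∨ (u = v' ∧ v = u') := by
  simp [targetEdge, Subtype.ext_iff]

@[simp] lemma depotEdge_ne_targetEdge (d : D) (t u v : T) (h : u ≠ v) :
    depotEdge d t ≠ targetEdge u v h := by
  simp [depotEdge, targetEdge, Subtype.ext_iff]

@[simp] lemma targetEdge_ne_depotEdge (d : D) (t u v : T) (h : u ≠ v) :
    targetEdge u v h ≠ depotEdge d t := (depotEdge_ne_targetEdge d t u v h).symm

@[simp] lemma depotEdge_mem_gam (d : D) (t : T) (S : Set T) :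
    depotEdge d t ∉ gam (tgt S) := by
  simp [depotEdge, gam, tgt]

@[simp] lemma targetEdge_mem_gam (u v : T) (h : u ≠ v) (S : Set T) :
    (targetEdge u v h : Edge T D) ∈ gam (tgt S) ↔ u ∈ S ∧ v ∈ S := by
  simp [targetEdge, gam, tgt]

@[simp] lemma depotEdge_mem_between_dep (d : D) (t : T) (A : Set D) (S : Set T) :
    depotEdge d t ∈ between (dep A) (tgt S) ↔ d ∈ A ∧ t ∈ S := by
  simp [depotEdge, between, dep, tgt]

@[simp] lemma targetEdge_mem_between_dep (u v : T) (h : u ≠ v) (A : Set D) (S : Set T) :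
    (targetEdge u v h : Edge T D) ∉ between (dep A) (tgt S) := by
  simp [targetEdge, between, dep, tgt]

@[simp] lemma depotEdge_mem_between_tgt (d : D) (t : T) (A : Set D) (S : Set T) :
    depotEdge d t ∈ between (tgt S) (dep A) ↔ t ∈ S ∧ d ∈ A := by
  simp [depotEdge, between, dep, tgt]

@[simp] lemma targetEdge_mem_between_tgt (u v : T) (h : u ≠ v) (A : Set D) (S : Set T) :
    (targetEdge u v h : Edge T D) ∉ between (tgt S) (dep A) := by
  simp [targetEdge, between, dep, tgt]

@[simp] lemma depotEdge_mem_del (d : D) (t : T) (S : Set T) :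
    depotEdge d t ∈ del (tgt S) ↔ t ∈ S := by
  simp [depotEdge, del, between, tgt]

@[simp] lemma targetEdge_mem_del (u v : T) (h : u ≠ v) (S : Set T) :
    (targetEdge u v h : Edge T D) ∈ del (tgt S) ↔ (u ∈ S ∧ v ∉ S) ∨ (v ∈ S ∧ u ∉ S) := by
  constructor
  · rintro ⟨a, ⟨a, ha, rfl⟩, b, hb, hab⟩
    rcases Sym2.eq_iff.1 hab with ⟨h1, rfl⟩ | ⟨rfl, h1⟩ <;> cases h1 <;> simp_all [tgt]
  · rintro (⟨hu, hv⟩ | ⟨hu, hv⟩)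
    · exact ⟨_, ⟨u, hu, rfl⟩, Sum.inl v, by simpa [tgt] using hv, rfl⟩
    · exact ⟨_, ⟨v, hu, rfl⟩, Sum.inl u, by simpa [tgt] using hv, Sym2.eq_swap⟩

lemma mem_del_singleton (e : Edge T D) (i : T) :
    e ∈ del (tgt {i}) ↔ (Sum.inl i : Vertex T D) ∈ e.1 := by
  rcases edge_cases e with ⟨d, t, rfl⟩ | ⟨u, v, h, rfl⟩
  · simp [eq_comm]
  · simp; grind

end Edges

/-! ### Linearity of edge sums -/

section Sums

variable {T D : Type*} [Fintype T] [Fintype D]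

lemma edgeSum_add (x x' : Edge T D → ℝ) (F : Set (Edge T D)) :
    edgeSum (x + x') F = edgeSum x F + edgeSum x' F := by
  simp only [edgeSum, ← Finset.sum_add_distrib]
  exact Finset.sum_congr rfl fun e _ => congrFun (Set.indicator_add F x x') e

lemma edgeSum_smul (c : ℝ) (x : Edge T D → ℝ) (F : Set (Edge T D)) :
    edgeSum (c • x) F = c * edgeSum x F := by
  simp only [edgeSum, Finset.mul_sum]
  refine Finset.sum_congr rfl fun e _ => ?_
  by_cases h : e ∈ F <;> simp [h]

@[simp] lemma edgeSum_zero (F : Set (Edge T D)) : edgeSum (0 : Edge T D → ℝ) F = 0 := by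
  simp [edgeSum]

lemma edgeSum_nonneg {x : Edge T D → ℝ} (hx : ∀ e, 0 ≤ x e) (F : Set (Edge T D)) :
    0 ≤ edgeSum x F :=
  Finset.sum_nonneg fun _ _ => Set.indicator_nonneg (fun e _ => hx e) _

open Classical in
lemma edgeSum_single (e : Edge T D) (c : ℝ) (F : Set (Edge T D)) :
    edgeSum (Pi.single e c) F = if e ∈ F then c else 0 := by
  rw [edgeSum, Finset.sum_eq_single e]
  · by_cases h : e ∈ F <;> simp [h]
  · intro b _ hb
    by_cases h : b ∈ F <;> simp [h, hb]
  · simp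

lemma pathLHS_add (j k : T) (hjk : j ≠ k) (D' : Set D) (x x' : Edge T D → ℝ) :
    pathLHS j k hjk D' (x + x') = pathLHS j k hjk D' x + pathLHS j k hjk D' x' := by
  simp only [pathLHS, edgeSum_add, Pi.add_apply]; ring

lemma pathLHS_smul (j k : T) (hjk : j ≠ k) (D' : Set D) (c : ℝ) (x : Edge T D → ℝ) :
    pathLHS j k hjk D' (c • x) = c * pathLHS j k hjk D' x := by
  simp only [pathLHS, edgeSum_smul, Pi.smul_apply, smul_eq_mul]; ring

end Sums

/-! ### Short tours and their disjoint sums -/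

section Parts

variable {T D : Type*} [Fintype T] [DecidableEq T] [Fintype D]

/-- Vectors satisfying all constraints of a feasible solution other than the covering of the
clusters, in a form that is stable under sums of vectors with disjoint supports. -/
structure IsTourPart (p : Space T D) : Prop where
  degree : ∀ i : T, edgeSum p.1 (del (tgt {i})) = 2 * p.2 i
  subtour : ∀ (S : Set T), ∀ i ∈ S, 2 * p.2 i ≤ edgeSum p.1 (del (tgt S))
  fourPath : ∀ (j k : T) (hjk : j ≠ k) (D' : Set D),
    pathLHS j k hjk D' p.1 ≤ 2 * (p.2 j + p.2 k)
  path_nonneg : ∀ (j k : T), j ≠ k → ∀ (S : Finset T), j ∉ S → k ∉ S → ∀ (D' : Set D),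
    edgeSum p.1 (between (dep D') (tgt {j})) + 2 * edgeSum p.1 (gam (tgt (↑S ∪ {j, k})))
        + edgeSum p.1 (between (tgt {k}) (dep D'ᶜ))
      ≤ ∑ v ∈ S, 2 * p.2 v + 2 * (p.2 j + p.2 k)
  path : ∀ (j k : T), j ≠ k → ∀ (S : Finset T), j ∉ S → k ∉ S → ∀ i ∈ S, ∀ (D' : Set D),
    edgeSum p.1 (between (dep D') (tgt {j})) + 2 * edgeSum p.1 (gam (tgt (↑S ∪ {j, k})))
        + edgeSum p.1 (between (tgt {k}) (dep D'ᶜ))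
      ≤ ∑ v ∈ S, 2 * p.2 v + 2 * (p.2 j + p.2 k) - p.2 i
  x_target : ∀ u v h, p.1 (targetEdge u v h) = 0 ∨ p.1 (targetEdge u v h) = 1
  x_depot : ∀ d t, p.1 (depotEdge d t) = 0 ∨ p.1 (depotEdge d t) = 1 ∨ p.1 (depotEdge d t) = 2
  y_binary : ∀ i : T, p.2 i = 0 ∨ p.2 i = 1
  support : ∀ (i : T) (e : Edge T D), Sum.inl i ∈ e.1 → p.2 i = 0 → p.1 e = 0

namespace IsTourPart

variable {p q : Space T D}

lemma x_nonneg (hp : IsTourPart p) (e : Edge T D) : 0 ≤ p.1 e := by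
  rcases edge_cases e with ⟨d, t, rfl⟩ | ⟨u, v, h, rfl⟩
  · rcases hp.x_depot d t with h | h | h <;> simp [h]
  · rcases hp.x_target u v h with h | h <;> simp [h]

lemma zero : IsTourPart (0 : Space T D) := by
  constructor <;> simp [pathLHS]

/-- The linear constraints are homogeneous, so they add up. Disjointness is needed for integrality:
by `support`, an edge meeting a target unselected in one summand has value 0 there. -/
lemma add (hp : IsTourPart p) (hq : IsTourPart q) (hpq : ∀ i, p.2 i = 0 ∨ q.2 i = 0) :
    IsTourPart (p + q) where
  degree i := by
    rw [Prod.fst_add, edgeSum_add, hp.degree, hq.degree, Prod.snd_add, Pi.add_apply]; ring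
  subtour S i hi := by
    have h1 := hp.subtour S i hi
    have h2 := hq.subtour S i hi
    have h3 := edgeSum_nonneg hp.x_nonneg (del (tgt S))
    have h4 := edgeSum_nonneg hq.x_nonneg (del (tgt S))
    rw [Prod.fst_add, edgeSum_add, Prod.snd_add, Pi.add_apply]
    linarith
  fourPath j k hjk D' := by
    have h1 := hp.fourPath j k hjk D'
    have h2 := hq.fourPath j k hjk D'
    simp only [Prod.fst_add, pathLHS_add, Prod.snd_add, Pi.add_apply]
    linarith
  path_nonneg j k hjk S hj hk D' := by
    have h1 := hp.path_nonneg j k hjk S hj hk D'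
    have h2 := hq.path_nonneg j k hjk S hj hk D'
    simp only [Prod.fst_add, edgeSum_add, Prod.snd_add, Pi.add_apply, mul_add,
      Finset.sum_add_distrib] at *
    linarith
  path j k hjk S hj hk i hi D' := by
    have h1 := hp.path j k hjk S hj hk i hi D'
    have h2 := hq.path j k hjk S hj hk i hi D'
    have h3 := hp.path_nonneg j k hjk S hj hk D'
    have h4 := hq.path_nonneg j k hjk S hj hk D'
    simp only [Prod.fst_add, edgeSum_add, Prod.snd_add, Pi.add_apply, mul_add,
      Finset.sum_add_distrib] at *
    rcases hpq i with h | h <;> rw [h] at * <;> linarith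
  x_target u v h := by
    rcases hpq u with h' | h'
    · simpa [hp.support u (targetEdge u v h) (by simp) h'] using hq.x_target u v h
    · simpa [hq.support u (targetEdge u v h) (by simp) h'] using hp.x_target u v h
  x_depot d t := by
    rcases hpq t with h' | h'
    · simpa [hp.support t (depotEdge d t) (by simp) h'] using hq.x_depot d t
    · simpa [hq.support t (depotEdge d t) (by simp) h'] using hp.x_depot d t
  y_binary i := by
    rcases hpq i with h' | h'
    · simpa [h'] using hq.y_binary i
    · simpa [h'] using hp.y_binary i
  support i e he h := by
    have hp0 : p.2 i = 0 ∧ q.2 i = 0 := by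
      rcases hpq i with h' | h' <;> simpa [h'] using h
    simp [hp.support i e he hp0.1, hq.support i e he hp0.2]

lemma isFeasible (hp : IsTourPart p) (C : Finpartition (Finset.univ : Finset T))
    (hC : ∀ A ∈ C.parts, ∃ i ∈ A, p.2 i = 1) : IsFeasible C p where
  degree := hp.degree
  assignment A hA := by
    obtain ⟨i, hi, h⟩ := hC A hA
    rw [← h]
    refine Finset.single_le_sum (f := p.2) (fun v _ => ?_) hi
    rcases hp.y_binary v with h | h <;> simp [h]
  subtour := hp.subtour
  fourPath := hp.fourPath
  path := hp.path
  x_target e he := by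
    rcases edge_cases e with ⟨d, t, rfl⟩ | ⟨u, v, h, rfl⟩
    · simp at he
    · exact hp.x_target u v h
  x_depot e he := by
    rcases edge_cases e with ⟨d, t, rfl⟩ | ⟨u, v, h, rfl⟩
    · exact hp.x_depot d t
    · simp at he
  y_binary := hp.y_binary

end IsTourPart

open Classical in
/-- The unit vector of an edge. -/
noncomputable def xUnit (e : Edge T D) : Space T D := (Pi.single e 1, 0)

/-- The unit vector of a target. -/
noncomputable def yUnit (i : T) : Space T D := (0, Pi.single i 1)

/-- The tour `d, i, d`. -/
noncomputable def tour₁ (d : D) (i : T) : Space T D :=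
  (2 : ℝ) • xUnit (depotEdge d i) + yUnit i

/-- The tour `d, u, v, d`. -/
noncomputable def tour₂ (d : D) (u v : T) (huv : u ≠ v) : Space T D :=
  xUnit (depotEdge d u) + xUnit (targetEdge u v huv) + xUnit (depotEdge d v) + yUnit u + yUnit v

/-- The tour `d, u, v, w, d`. -/
noncomputable def tour₃ (d : D) (u v w : T) (huv : u ≠ v) (hvw : v ≠ w) : Space T D :=
  xUnit (depotEdge d u) + xUnit (targetEdge u v huv) + xUnit (targetEdge v w hvw)
    + xUnit (depotEdge d w) + yUnit u + yUnit v + yUnit w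

open Classical in
lemma xUnit_fst_apply (e e' : Edge T D) :
    (xUnit e : Space T D).1 e' = if e' = e then 1 else 0 := by
  simp [xUnit, Pi.single_apply]

@[simp] lemma xUnit_snd (e : Edge T D) : (xUnit e : Space T D).2 = 0 := rfl

@[simp] lemma yUnit_fst (i : T) : (yUnit i : Space T D).1 = 0 := rfl

lemma yUnit_snd_apply (i i' : T) :
    (yUnit i : Space T D).2 i' = if i' = i then 1 else 0 := by
  simp [yUnit, Pi.single_apply]

open Classical in
lemma edgeSum_xUnit (e : Edge T D) (F : Set (Edge T D)) :
    edgeSum (xUnit e : Space T D).1 F = if e ∈ F then 1 else 0 := by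
  unfold xUnit
  convert edgeSum_single e 1 F

lemma isTourPart_tour₁ (d : D) (i : T) : IsTourPart (tour₁ d i) := by
  classical
  constructor
  · intro t
    simp [tour₁, edgeSum_smul, edgeSum_xUnit, yUnit_snd_apply, eq_comm]
  · intro S t ht
    simp [tour₁, edgeSum_smul, edgeSum_xUnit, yUnit_snd_apply]
    grind
  · intro j k hjk D'
    simp [tour₁, pathLHS, edgeSum_smul, edgeSum_xUnit, xUnit_fst_apply,
      yUnit_snd_apply]
    grind
  · intro j k hjk S hj hk D'
    simp [tour₁, edgeSum_smul, edgeSum_xUnit, yUnit_snd_apply]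
    grind
  · intro j k hjk S hj hk t ht D'
    simp [tour₁, edgeSum_smul, edgeSum_xUnit, yUnit_snd_apply]
    grind
  · intro u v h
    simp [tour₁, xUnit_fst_apply]
  · intro d' t
    simp [tour₁, xUnit_fst_apply]
    grind
  · intro t
    simp [tour₁, yUnit_snd_apply]
    grind
  · intro t e he
    simp [tour₁, xUnit_fst_apply, yUnit_snd_apply]
    rintro h rfl
    simp at he
    exact h he

/-- Each constraint reduces to a finite case analysis on which ends lie in the given sets. The path
constraints hold because both depot edges use the same depot, which cannot lie both in `D'` and
outside it. -/
lemma isTourPart_tour₂ (d : D) (u v : T) (huv : u ≠ v) : IsTourPart (tour₂ d u v huv) := by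
  classical
  constructor
  · intro t
    simp [tour₂, edgeSum_add, edgeSum_xUnit, yUnit_snd_apply]
    grind (splits := 30)
  · intro S t ht
    simp [tour₂, edgeSum_add, edgeSum_xUnit, yUnit_snd_apply]
    grind (splits := 30)
  · intro j k hjk D'
    simp [tour₂, pathLHS, edgeSum_add, edgeSum_xUnit, xUnit_fst_apply, yUnit_snd_apply]
    grind (splits := 30)
  · intro j k hjk S hj hk D'
    simp [tour₂, edgeSum_add, edgeSum_xUnit, yUnit_snd_apply, mul_add, Finset.sum_add_distrib]
    grind (splits := 30)
  · intro j k hjk S hj hk t ht D'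
    simp [tour₂, edgeSum_add, edgeSum_xUnit, yUnit_snd_apply, mul_add, Finset.sum_add_distrib]
    grind (splits := 30)
  · intro a b h
    simp [tour₂, xUnit_fst_apply]
    grind (splits := 30)
  · intro d' t
    simp [tour₂, xUnit_fst_apply]
    grind (splits := 30)
  · intro t
    simp [tour₂, yUnit_snd_apply]
    grind (splits := 30)
  · intro t e he
    rcases edge_cases e with ⟨d, t, rfl⟩ | ⟨u, v, h, rfl⟩ <;>
    simp [tour₂, xUnit_fst_apply, yUnit_snd_apply] at * <;> grind

lemma isTourPart_tour₃ (d : D) (u v w : T) (huv : u ≠ v) (hvw : v ≠ w) (huw : u ≠ w) :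
    IsTourPart (tour₃ d u v w huv hvw) := by
  classical
  constructor
  · intro t
    simp [tour₃, edgeSum_add, edgeSum_xUnit, yUnit_snd_apply]
    grind (splits := 30)
  · intro S t ht
    simp [tour₃, edgeSum_add, edgeSum_xUnit, yUnit_snd_apply]
    grind (splits := 30)
  · intro j k hjk D'
    simp [tour₃, pathLHS, edgeSum_add, edgeSum_xUnit, xUnit_fst_apply, yUnit_snd_apply]
    grind (splits := 30)
  · intro j k hjk S hj hk D'
    simp [tour₃, edgeSum_add, edgeSum_xUnit, yUnit_snd_apply, mul_add, Finset.sum_add_distrib]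
    grind (splits := 30)
  · intro j k hjk S hj hk t ht D'
    simp [tour₃, edgeSum_add, edgeSum_xUnit, yUnit_snd_apply, mul_add, Finset.sum_add_distrib]
    grind (splits := 30)
  · intro a b h
    simp [tour₃, xUnit_fst_apply]
    grind (splits := 30)
  · intro d' t
    simp [tour₃, xUnit_fst_apply]
    grind (splits := 30)
  · intro t
    simp [tour₃, yUnit_snd_apply]
    grind (splits := 30)
  · intro t e he
    rcases edge_cases e with ⟨d, t, rfl⟩ | ⟨u, v, h, rfl⟩ <;>
    simp [tour₃, xUnit_fst_apply, yUnit_snd_apply] at * <;> grind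

end Parts

end GMDTSP

namespace GMDTSP

/-! ### A codimension-one criterion by linear functionals -/

section LinearAlgebra

variable {V : Type*} [AddCommGroup V] [Module ℝ V]

/-- A face `F` has codimension one in `P` as soon as it differs from `P` and every linear functional
that is constant on `F` and on one further point of `P` is constant on `P`. -/
lemma affDim_add_one_of_forall_functional [FiniteDimensional ℝ V] {P F : Set V} (hFP : F ⊆ P) {p₀ q : V} (hp₀ : p₀ ∈ F)
    (hq : q ∈ P) (L : V →ₗ[ℝ] ℝ) (hL : ∀ p ∈ F, L p = L p₀) (hLq : L q ≠ L p₀)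
    (h : ∀ f : V →ₗ[ℝ] ℝ, (∀ p ∈ F, f p = f p₀) → f q = f p₀ → ∀ p ∈ P, f p = f p₀) :
    affDim F + 1 = affDim P := by
  have hspan : vectorSpan ℝ P = vectorSpan ℝ F ⊔ Submodule.span ℝ {q - p₀} := by
    apply le_antisymm
    · rw [vectorSpan_eq_span_vsub_set_right ℝ (hFP hp₀), Submodule.span_le]
      rintro _ ⟨p, hp, rfl⟩
      by_contra hnot
      -- A vector outside a subspace is detected by a functional vanishing on that subspace.
      obtain ⟨f, hf, hle⟩ := Submodule.exists_le_ker_of_notMem hnot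
      refine hf ?_
      have hF : ∀ p ∈ F, f p = f p₀ := fun p hp => by
        have : f (p - p₀) = 0 := hle (Submodule.mem_sup_left (vsub_mem_vectorSpan ℝ hp hp₀))
        rwa [map_sub, sub_eq_zero] at this
      have hq' : f q = f p₀ := by
        have : f (q - p₀) = 0 :=
          hle (Submodule.mem_sup_right (Submodule.mem_span_singleton_self _))
        rwa [map_sub, sub_eq_zero] at this
      change f (p - p₀) = 0
      rw [map_sub, h f hF hq' p hp, sub_self]
    · refine sup_le (vectorSpan_mono ℝ hFP) ?_
      rw [Submodule.span_singleton_le_iff_mem]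
      exact vsub_mem_vectorSpan ℝ hq (hFP hp₀)
  -- `L` vanishes on the directions of `F` but not on `q - p₀`, so adjoining `q` raises the
  -- dimension by exactly one.
  have hker : vectorSpan ℝ F ≤ LinearMap.ker L := by
    rw [vectorSpan_eq_span_vsub_set_right ℝ hp₀, Submodule.span_le]
    rintro _ ⟨p, hp, rfl⟩
    change L (p - p₀) = 0
    rw [map_sub, hL p hp, sub_self]
  have hnot : q - p₀ ∉ vectorSpan ℝ F := fun hmem => hLq (by
    have : L (q - p₀) = 0 := hker hmem
    rwa [map_sub, sub_eq_zero] at this)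
  have hdisj : Disjoint (vectorSpan ℝ F) (Submodule.span ℝ {q - p₀}) :=
    (Submodule.disjoint_span_singleton_of_notMem hnot)
  have hne : q - p₀ ≠ 0 := fun h0 => hnot (h0 ▸ Submodule.zero_mem _)
  rw [affDim, affDim, hspan, ← finrank_span_singleton (K := ℝ) hne,
    ← Submodule.finrank_sup_add_finrank_inf_eq, disjoint_iff.1 hdisj, finrank_bot, add_zero]

lemma eq_of_mem_convexHull {X : Set V} (f : V →ₗ[ℝ] ℝ) {c : ℝ} (h : ∀ p ∈ X, f p = c) :
    ∀ p ∈ convexHull ℝ X, f p = c :=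
  fun _ hp => convexHull_min (t := {p | f p = c}) h (convex_hyperplane f.isLinear c) hp

lemma nonneg_of_mem_convexHull {X : Set V} (f : V →ₗ[ℝ] ℝ) (h : ∀ p ∈ X, 0 ≤ f p) :
    ∀ p ∈ convexHull ℝ X, 0 ≤ f p :=
  fun _ hp => convexHull_min (t := {p | 0 ≤ f p}) h (convex_halfSpace_ge f.isLinear 0) hp

end LinearAlgebra

end GMDTSP

namespace GMDTSP

/-! ### The slack as a linear functional -/

section Slack

variable {T D : Type*} [Fintype T] [DecidableEq T] [Fintype D]

/-- The slack of the inequality `x(D' : {j}) + 3 x_{jk} + x({k} : D ∖ D') ≤ 2 (y_j + y_k)`. -/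
noncomputable def slack (j k : T) (hjk : j ≠ k) (D' : Set D) : Space T D →ₗ[ℝ] ℝ where
  toFun p := 2 * (p.2 j + p.2 k) - pathLHS j k hjk D' p.1
  map_add' p q := by
    simp only [Prod.fst_add, Prod.snd_add, Pi.add_apply, pathLHS_add]; ring
  map_smul' c p := by
    simp only [Prod.smul_fst, Prod.smul_snd, Pi.smul_apply, pathLHS_smul, smul_eq_mul,
      RingHom.id_apply]; ring

lemma slack_apply (j k : T) (hjk : j ≠ k) (D' : Set D) (p : Space T D) :
    slack j k hjk D' p = 2 * (p.2 j + p.2 k) - pathLHS j k hjk D' p.1 := rfl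

open Classical in
lemma slack_xUnit_depotEdge (j k : T) (hjk : j ≠ k) (D' : Set D) (d : D) (t : T) :
    slack j k hjk D' (xUnit (depotEdge d t)) =
      -((if d ∈ D' ∧ t = j then 1 else 0) + if t = k ∧ d ∉ D' then 1 else 0) := by
  simp [slack_apply, pathLHS, edgeSum_xUnit, xUnit_fst_apply]

lemma slack_xUnit_targetEdge (j k : T) (hjk : j ≠ k) (D' : Set D) (u v : T) (h : u ≠ v) :
    slack j k hjk D' (xUnit (targetEdge u v h)) =
      -(if (j = u ∧ k = v) ∨ (j = v ∧ k = u) then 3 else 0) := by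
  simp [slack_apply, pathLHS, edgeSum_xUnit, xUnit_fst_apply]

lemma slack_yUnit (j k : T) (hjk : j ≠ k) (D' : Set D) (i : T) :
    slack j k hjk D' (yUnit i) = 2 * ((if j = i then 1 else 0) + if k = i then 1 else 0) := by
  simp [slack_apply, pathLHS, yUnit_snd_apply]

end Slack

/-! ### Exchange of tours and determination of the coefficients -/

section Tours

variable {T D : Type*} [Fintype T] [DecidableEq T] [Fintype D]

lemma tour₁_snd_apply (d : D) (i t : T) :
    (tour₁ d i).2 t = if t ∈ ({i} : Finset T) then 1 else 0 := by
  simp [tour₁, yUnit_snd_apply]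

lemma tour₂_snd_apply (d : D) (u v : T) (huv : u ≠ v) (t : T) :
    (tour₂ d u v huv).2 t = if t ∈ ({u, v} : Finset T) then 1 else 0 := by
  simp [tour₂, yUnit_snd_apply]; grind

lemma tour₃_snd_apply (d : D) (u v w : T) (huv : u ≠ v) (hvw : v ≠ w) (huw : u ≠ w) (t : T) :
    (tour₃ d u v w huv hvw).2 t = if t ∈ ({u, v, w} : Finset T) then 1 else 0 := by
  simp [tour₃, yUnit_snd_apply]; grind

/-- Every target in `R` is served alone, from the depot that `σ` assigns to it. -/
noncomputable def singleTours (R : Finset T) (σ : T → D) : Space T D := ∑ i ∈ R, tour₁ (σ i) i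

lemma singleTours_snd_apply (R : Finset T) (σ : T → D) (t : T) :
    (singleTours R σ).2 t = if t ∈ R then 1 else 0 := by
  simp [singleTours, Prod.snd_sum, tour₁_snd_apply]

lemma isTourPart_singleTours (R : Finset T) (σ : T → D) : IsTourPart (singleTours R σ) := by
  induction R using Finset.induction_on with
  | empty => simpa [singleTours] using IsTourPart.zero
  | insert i R hi ih =>
    rw [singleTours, Finset.sum_insert hi]
    refine (isTourPart_tour₁ (σ i) i).add ih fun t => ?_
    change _ ∨ (singleTours R σ).2 t = 0
    rw [tour₁_snd_apply, singleTours_snd_apply]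
    by_cases h : t = i
    · subst h; simp [hi]
    · simp [h]

lemma isFeasible_singleTours_compl_add (C : Finpartition (Finset.univ : Finset T)) {Q : Space T D}
    {R : Finset T} (hQ : IsTourPart Q) (hQR : ∀ t, Q.2 t = if t ∈ R then 1 else 0) (σ : T → D) :
    IsFeasible C (singleTours Rᶜ σ + Q) := by
  refine ((isTourPart_singleTours _ σ).add hQ fun t => ?_).isFeasible C fun A hA => ?_
  · rw [singleTours_snd_apply, hQR]
    by_cases h : t ∈ R <;> simp [h]
  · obtain ⟨i, hi⟩ := C.nonempty_of_mem_parts hA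
    refine ⟨i, hi, ?_⟩
    rw [Prod.snd_add, Pi.add_apply, singleTours_snd_apply, hQR]
    by_cases h : i ∈ R <;> simp [h]

lemma isFeasible_singleTours_univ (C : Finpartition (Finset.univ : Finset T)) (σ : T → D) :
    IsFeasible C (singleTours Finset.univ σ) :=
  (isTourPart_singleTours _ σ).isFeasible C fun A hA => by
    obtain ⟨i, hi⟩ := C.nonempty_of_mem_parts hA
    exact ⟨i, hi, by simp [singleTours_snd_apply]⟩

/-- Dropping `t` can uncover only the cluster `{t}`. -/
lemma isFeasible_singleTours_erase (C : Finpartition (Finset.univ : Finset T)) (σ : T → D) {t : T}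
    (ht : {t} ∉ C.parts) : IsFeasible C (singleTours (Finset.univ.erase t) σ) :=
  (isTourPart_singleTours _ σ).isFeasible C fun A hA => by
    by_contra! hcon
    have hsub : ∀ i ∈ A, i = t := fun i hi => by
      by_contra hit
      exact hcon i hi (by simp [singleTours_snd_apply, hit])
    exact ht ((Finset.eq_singleton_iff_nonempty_unique_mem.2
      ⟨C.nonempty_of_mem_parts hA, hsub⟩) ▸ hA)

/-- Each single tour is tight by itself: the doubled depot edge at `j` or `k` is counted and cancels
`2 y_j` or `2 y_k`, and other targets do not enter. Hence dropping targets preserves tightness. -/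
lemma slack_singleTours {j k : T} (hjk : j ≠ k) {D' : Set D} {σ : T → D} (hj : σ j ∈ D')
    (hk : σ k ∉ D') (R : Finset T) : slack j k hjk D' (singleTours R σ) = 0 := by
  rw [singleTours, map_sum]
  refine Finset.sum_eq_zero fun i _ => ?_
  simp only [tour₁, map_add, map_smul, slack_xUnit_depotEdge, slack_yUnit, smul_eq_mul]
  grind

/-- A functional that is constant on the tight feasible solutions takes the same value on a tight
vector and on the single tours that it can be exchanged for. -/
lemma map_eq_sum_tour₁ (C : Finpartition (Finset.univ : Finset T)) {j k : T} (hjk : j ≠ k)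
    {D' : Set D} {σ : T → D} (hj : σ j ∈ D') (hk : σ k ∉ D') {f : Space T D →ₗ[ℝ] ℝ} {c : ℝ}
    (hf : ∀ p, IsFeasible C p → slack j k hjk D' p = 0 → f p = c)
    {Q : Space T D} {R : Finset T} (hQ : IsTourPart Q)
    (hQR : ∀ t, Q.2 t = if t ∈ R then 1 else 0) (hs : slack j k hjk D' Q = 0) :
    f Q = ∑ i ∈ R, f (tour₁ (σ i) i) := by
  have h1 := hf _ (isFeasible_singleTours_compl_add C hQ hQR σ)
    (by rw [map_add, slack_singleTours hjk hj hk, hs, add_zero])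
  have h2 := hf _ (isFeasible_singleTours_univ C σ) (slack_singleTours hjk hj hk _)
  rw [map_add] at h1
  rw [singleTours, map_sum, ← Finset.sum_compl_add_sum R] at h2
  rw [singleTours, map_sum] at h1
  linarith

lemma eq_sum_units (p : Space T D) :
    p = ∑ e, p.1 e • xUnit e + ∑ i, p.2 i • (yUnit i : Space T D) := by
  ext x
  · simp [Prod.fst_sum, xUnit_fst_apply]
  · simp [Prod.snd_sum, yUnit_snd_apply]

/-- A functional whose coefficients on edges are sums of weights of the targets on the edge takes a
value on feasible solutions that depends only on the selected targets. -/
lemma map_eq_sum_of_edge_weights {C : Finpartition (Finset.univ : Finset T)}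
    {f : Space T D →ₗ[ℝ] ℝ} {α : T → ℝ} (hd : ∀ d t, f (xUnit (depotEdge d t)) = α t)
    (ht : ∀ u v h, f (xUnit (targetEdge u v h)) = α u + α v) {p : Space T D}
    (hp : IsFeasible C p) : f p = ∑ t, (2 * α t + f (yUnit t)) * p.2 t := by
  classical
  -- Spreading each edge coefficient over its target ends turns the sum over edges into a sum over
  -- degrees, which are `2 y_t`.
  have hedge : ∀ e : Edge T D, f (xUnit e) = ∑ t, if e ∈ del (tgt {t}) then α t else 0 := by
    intro e
    simp only [mem_del_singleton]
    rcases edge_cases e with ⟨d, t, rfl⟩ | ⟨u, v, h, rfl⟩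
    · simp [hd]
    · simp only [ht, inl_mem_targetEdge]
      rw [← Finset.sum_filter, Finset.filter_or, Finset.sum_union]
      · simp [Finset.filter_eq']
      · simp [Finset.filter_eq', h]
  have hsum : ∑ e, p.1 e * f (xUnit e) = ∑ t, α t * (2 * p.2 t) := by
    simp only [hedge, Finset.mul_sum, ← hp.degree, edgeSum]
    rw [Finset.sum_comm]
    refine Finset.sum_congr rfl fun t _ => Finset.sum_congr rfl fun e _ => ?_
    by_cases h : e ∈ del (tgt {t}) <;> simp [h, mul_comm]
  conv_lhs => rw [eq_sum_units p]
  simp only [map_add, map_sum, map_smul, smul_eq_mul]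
  rw [hsum, ← Finset.sum_add_distrib]
  exact Finset.sum_congr rfl fun t _ => by ring

/-- A functional that is constant on the tight feasible solutions and takes the same value on one
feasible solution that is not tight is constant on all feasible solutions. -/
lemma map_eq_of_isFeasible (C : Finpartition (Finset.univ : Finset T)) {j k : T} (hjk : j ≠ k)
    {D' : Set D} {σ : T → D} (hj : σ j ∈ D') (hk : σ k ∉ D') {d₁ : D} (hd₁ : d₁ ∉ D')
    {f : Space T D →ₗ[ℝ] ℝ} {c : ℝ}
    (hf : ∀ p, IsFeasible C p → slack j k hjk D' p = 0 → f p = c)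
    (hq : f (singleTours {j}ᶜ σ + tour₁ d₁ j) = c) {p : Space T D} (hp : IsFeasible C p) :
    f p = c := by
  have hsT : ∀ R, f (singleTours R σ) = ∑ i ∈ R, f (tour₁ (σ i) i) := fun R => by
    rw [singleTours, map_sum]
  have huniv := hf _ (isFeasible_singleTours_univ C σ) (slack_singleTours hjk hj hk _)
  have hex := @map_eq_sum_tour₁ T D _ _ _ C j k hjk D' σ hj hk f c hf
  have hf₁ : ∀ d i, f (tour₁ d i) = 2 * f (xUnit (depotEdge d i)) + f (yUnit i) := fun d i => by
    simp [tour₁]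
  set α : T → ℝ := fun t => f (xUnit (depotEdge (σ t) t)) with hα
  have hσ : ∀ t, f (tour₁ (σ t) t) = 2 * α t + f (yUnit t) := fun t => hf₁ _ _
  have hd_of : ∀ d t, slack j k hjk D' (tour₁ d t) = 0 → f (xUnit (depotEdge d t)) = α t := by
    intro d t hs
    have := hex (isTourPart_tour₁ d t) (tour₁_snd_apply d t) hs
    rw [Finset.sum_singleton, hσ, hf₁] at this
    linarith
  -- The only use of the non-tight point: it differs from the all-single solution just in the depot
  -- serving `j`.
  have hd_j₁ : f (xUnit (depotEdge d₁ j)) = α j := by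
    rw [map_add, hsT, hf₁] at hq
    rw [hsT, ← Finset.sum_compl_add_sum {j}, Finset.sum_singleton, hσ] at huniv
    linarith
  have hpair : ∀ d u v h, slack j k hjk D' (tour₂ d u v h) = 0 →
      f (xUnit (depotEdge d u)) + f (xUnit (targetEdge u v h)) + f (xUnit (depotEdge d v))
        = 2 * α u + 2 * α v := by
    intro d u v h hs
    have := hex (isTourPart_tour₂ d u v h) (tour₂_snd_apply d u v h) hs
    rw [Finset.sum_pair h, hσ, hσ] at this
    simp only [tour₂, map_add] at this
    linarith
  -- Tight for every depot: exactly one of the two depot edges is counted, and 3 + 1 = 4.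
  have hjkd : ∀ d, f (xUnit (depotEdge d j)) + f (xUnit (targetEdge j k hjk))
      + f (xUnit (depotEdge d k)) = 2 * α j + 2 * α k := fun d => hpair d j k hjk (by
    simp only [tour₂, map_add, slack_xUnit_depotEdge, slack_xUnit_targetEdge, slack_yUnit]
    grind)
  have hd_j : ∀ d ∈ D', f (xUnit (depotEdge d j)) = α j := fun d hd => hd_of d j (by
    simp only [tour₁, map_add, map_smul, slack_xUnit_depotEdge, slack_yUnit, smul_eq_mul]
    grind)
  have hd_k : ∀ d ∉ D', f (xUnit (depotEdge d k)) = α k := fun d hd => hd_of d k (by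
    simp only [tour₁, map_add, map_smul, slack_xUnit_depotEdge, slack_yUnit, smul_eq_mul]
    grind)
  have hjk_edge : f (xUnit (targetEdge j k hjk)) = α j + α k := by
    have := hjkd d₁
    rw [hd_j₁, hd_k _ hd₁] at this
    linarith
  have hd : ∀ d t, f (xUnit (depotEdge d t)) = α t := by
    intro d t
    have hdjk := hjkd d
    by_cases hdD : d ∈ D'
    · have := hd_j d hdD
      by_cases htk : t = k
      · subst htk; linarith
      · by_cases htj : t = j
        · subst htj; linarith
        · apply hd_of
          simp only [tour₁, map_add, map_smul, slack_xUnit_depotEdge, slack_yUnit, smul_eq_mul]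
          grind
    · have := hd_k d hdD
      by_cases htj : t = j
      · subst htj; linarith
      · by_cases htk : t = k
        · subst htk; linarith
        · apply hd_of
          simp only [tour₁, map_add, map_smul, slack_xUnit_depotEdge, slack_yUnit, smul_eq_mul]
          grind
  -- A two-target tour containing just one of `j`, `k` is never tight, so an edge from another
  -- target to `j` or `k` is reached by extending the path `j, k`.
  have htriple : ∀ d u v w huv hvw, u ≠ w → slack j k hjk D' (tour₃ d u v w huv hvw) = 0 →
      f (xUnit (targetEdge u v huv)) + f (xUnit (targetEdge v w hvw))
        = α u + 2 * α v + α w := by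
    intro d u v w huv hvw huw hs
    have := hex (isTourPart_tour₃ d u v w huv hvw huw) (tour₃_snd_apply d u v w huv hvw huw) hs
    rw [Finset.sum_insert (by simp [huv, huw]), Finset.sum_pair hvw, hσ, hσ, hσ] at this
    simp only [tour₃, map_add, hd] at this
    linarith
  -- With `j` inside the path only the depot edge at `k` can count, so the depot must lie outside
  -- `D'`; for `ht_k` it must lie in `D'`.
  have ht_j : ∀ t (h : t ≠ j), t ≠ k → f (xUnit (targetEdge t j h)) = α t + α j := by
    intro t h htk
    have := htriple d₁ t j k h hjk htk (by
      simp only [tour₃, map_add, slack_xUnit_depotEdge, slack_xUnit_targetEdge, slack_yUnit]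
      grind)
    linarith
  have ht_k : ∀ t (h : k ≠ t), t ≠ j → f (xUnit (targetEdge k t h)) = α k + α t := by
    intro t h htj
    have := htriple (σ j) j k t hjk h htj.symm (by
      simp only [tour₃, map_add, slack_xUnit_depotEdge, slack_xUnit_targetEdge, slack_yUnit]
      grind)
    linarith
  have ht : ∀ u v h, f (xUnit (targetEdge u v h)) = α u + α v := by
    intro u v h
    by_cases huj : u = j
    · subst huj
      by_cases hvk : v = k
      · subst hvk; exact hjk_edge
      · rw [targetEdge_swap, ht_j v h.symm hvk, add_comm]
    by_cases huk : u = k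
    · subst huk
      by_cases hvj : v = j
      · subst hvj; rw [targetEdge_swap, hjk_edge, add_comm]
      · exact ht_k v h hvj
    by_cases hvj : v = j
    · subst hvj; exact ht_j u h huk
    by_cases hvk : v = k
    · subst hvk; rw [targetEdge_swap, ht_k u h.symm huj, add_comm]
    have := hpair d₁ u v h (by
      simp only [tour₂, map_add, slack_xUnit_depotEdge, slack_xUnit_targetEdge, slack_yUnit]
      grind)
    rw [hd, hd] at this
    linarith
  rw [map_eq_sum_of_edge_weights hd ht hp, ← huniv, hsT]
  refine Finset.sum_congr rfl fun t _ => ?_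
  rw [hσ]
  -- A singleton cluster forces `y_t = 1`; otherwise comparison with the tight solution omitting `t`
  -- makes the coefficient zero.
  by_cases htC : {t} ∈ C.parts
  · have h1 := hp.assignment _ htC
    rw [Finset.sum_singleton] at h1
    rcases hp.y_binary t with h | h
    · linarith
    · rw [h, mul_one]
  · have h1 := hf _ (isFeasible_singleTours_erase C σ htC) (slack_singleTours hjk hj hk _)
    rw [hsT] at huniv h1
    rw [← Finset.add_sum_erase _ _ (Finset.mem_univ t), hσ] at huniv
    have h2 : 2 * α t + f (yUnit t) = 0 := by linarith
    rw [h2, zero_mul]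

end Tours

/-! ### The facet theorem -/

lemma fourPath_isFacetDefining {T D : Type*} [Fintype T] [DecidableEq T] [Fintype D]
    (C : Finpartition (Finset.univ : Finset T)) (j k : T) (hjk : j ≠ k)
    (D' : Set D) (hne : D'.Nonempty) (hproper : D' ≠ Set.univ) :
    IsFacetDefining (polytope D C)
      (fun p => pathLHS j k hjk D' p.1) (fun p => 2 * (p.2 j + p.2 k)) := by
  obtain ⟨d₀, hd₀⟩ := hne
  obtain ⟨d₁, hd₁⟩ := (Set.ne_univ_iff_exists_notMem D').1 hproper
  have hnonneg : ∀ p ∈ polytope D C, 0 ≤ slack j k hjk D' p :=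
    nonneg_of_mem_convexHull _ fun p hp => by
      have := hp.fourPath j k hjk D'
      rw [slack_apply]; linarith
  set σ : T → D := fun t => if t = j then d₀ else d₁ with hσ
  have hj : σ j ∈ D' := by simpa [hσ] using hd₀
  have hk : σ k ∉ D' := by simpa [hσ, hjk.symm] using hd₁
  have hface : ∀ p : Space T D, pathLHS j k hjk D' p.1 = 2 * (p.2 j + p.2 k) ↔
      slack j k hjk D' p = 0 := fun p => by
    rw [slack_apply, sub_eq_zero, eq_comm]
  have hp₀ := isFeasible_singleTours_univ C σ
  have hs₀ := slack_singleTours hjk hj hk Finset.univ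
  -- The non-tight point: `j` is served from `d₁` outside `D'`, so its depot edge is not counted and
  -- the slack is 2.
  have hq := isFeasible_singleTours_compl_add C (isTourPart_tour₁ d₁ j) (tour₁_snd_apply d₁ j) σ
  refine ⟨fun p hp => ?_, ⟨_, subset_convexHull _ _ hp₀, (hface _).2 hs₀⟩, ?_⟩
  · have := hnonneg p hp
    rw [slack_apply] at this
    change pathLHS j k hjk D' p.1 ≤ 2 * (p.2 j + p.2 k)
    linarith
  simp only [hface]
  refine affDim_add_one_of_forall_functional (fun p hp => hp.1)
    ⟨subset_convexHull _ _ hp₀, hs₀⟩ (subset_convexHull _ _ hq) (slack j k hjk D')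
    (fun p hp => hp.2.trans hs₀.symm) ?_ fun f hf hfq => ?_
  · rw [hs₀, map_add, slack_singleTours hjk hj hk]
    simp [tour₁, slack_xUnit_depotEdge, slack_yUnit, hd₁, hjk, hjk.symm]
  · exact eq_of_mem_convexHull f fun p hp => map_eq_of_isFeasible C hjk hj hk hd₁
      (fun p hp hs => hf p ⟨subset_convexHull _ _ hp, hs⟩) hfq hp

end GMDTSP

theorem proposition5 {T D : Type*} [Fintype T] [DecidableEq T] [Fintype D]
    (C : Finpartition (Finset.univ : Finset T))
    (j k : T) (hjk : j ≠ k)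
    (D' : Set D) (hne : D'.Nonempty) (hproper : D' ≠ Set.univ) :
    (GMDTSP.IsValid (GMDTSP.polytope D C)
        (fun p => GMDTSP.pathLHS j k hjk D' p.1 + 2 * (1 - p.2 j) + 2 * (1 - p.2 k))
        (fun _ => 4) ∧
      GMDTSP.IsFacetDefining (GMDTSP.polytope D C)
        (fun p => GMDTSP.pathLHS j k hjk D' p.1 + 2 * (1 - p.2 j) + 2 * (1 - p.2 k))
        (fun _ => 4)) ∧
    (GMDTSP.IsValid (GMDTSP.polytope D C)
        (fun p => GMDTSP.pathLHS j k hjk D' p.1) (fun p => 2 * (p.2 j + p.2 k)) ∧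
      GMDTSP.IsFacetDefining (GMDTSP.polytope D C)
        (fun p => GMDTSP.pathLHS j k hjk D' p.1) (fun p => 2 * (p.2 j + p.2 k))) := by
  have h := GMDTSP.fourPath_isFacetDefining C j k hjk D' hne hproper
  have hlift : GMDTSP.IsFacetDefining (GMDTSP.polytope D C)
      (fun p => GMDTSP.pathLHS j k hjk D' p.1 + 2 * (1 - p.2 j) + 2 * (1 - p.2 k))
      (fun _ => 4) := by
    -- Both forms differ by moving `4 - 2 (y_j + y_k)` across, so they cut out the same face.
    have hface : ∀ p : GMDTSP.Space T D,
        GMDTSP.pathLHS j k hjk D' p.1 + 2 * (1 - p.2 j) + 2 * (1 - p.2 k) = 4 ↔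
          GMDTSP.pathLHS j k hjk D' p.1 = 2 * (p.2 j + p.2 k) := fun p => by
      constructor <;> intro h <;> linarith
    refine ⟨fun p hp => ?_, ?_⟩
    · have := h.1 p hp
      dsimp only at this ⊢
      linarith
    · simp only [hface]
      exact h.2
  exact ⟨⟨hlift.1, hlift⟩, h.1, h⟩
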